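/- Let $N_+,N_-\ge 0$ be integers, not both zero, and let $a_{-N_-},\dots,a_{N_+}\in\mathbb{C}$ with $a_{N_+}\neq 0$ and $a_{-N_-}\neq 0$. Let $(\tau u)(k)=u(k-1)$ be the right translation on functions $u:\mathbb{Z}\to\mathbb{C}$, and put $$p(\tau)=\sum_{j=-N_-}^{N_+}a_j\tau^j,\qquad p(\zeta)=\sum_{j=-N_-}^{N_+}a_j\zeta^j\quad(\zeta\in\mathbb{C}\setminus\{0\}).$$ For $N\ge 1$ let $P_N=1_{[1,N]}\,p(\tau)\,1_{[1,N]}$, acting on $\ell^2(\{1,\dots,N\})\simeq\mathbb{C}^N$; that is, $P_N$ is the $N\times N$ Toeplitz matrix with entries $(P_N)_{k,l}=a_{k-l}$, where $a_j=0$ for $j\notin[-N_-,N_+]$. Let $S^1\subset\mathbb{C}$ be the unit circle. For $z\notin p(S^1)$ let $$\mathrm{ind}_{p(S^1)}(z)=\frac{1}{2\pi i}\int_0^{2\pi}\frac{\frac{d}{d\theta}p(e^{i\theta})}{p(e^{i\theta})-z}\,d\theta$$ be the winding number around $z$ of the closed curve $\theta\mapsto p(e^{i\theta})$, $0\le\theta\le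 2\pi$. Let $\Omega\subset\mathbb{C}\setminus(\{0\}\cup p(S^1))$ be a compact set such that, for every $z\in\Omega$, $\mathrm{ind}_{p(S^1)}(z)=0$ and, if $N_+=0$ or $N_-=0$, $z\neq a_0$. Then there exist a constant $C>0$ and an integer $N_0\ge 1$ such that for all $N\ge N_0$ and all $z\in\Omega$ the operator $P_N-z$ is invertible and $$\|(P_N-z)^{-1}\|\le C,$$ where $\|\cdot\|$ is the operator norm on $\ell^2(\{1,\dots,N\})$. -/

import Mathlib

open scoped BigOperators

noncomputable section

namespace BandToeplitz

/-- The translation to the right by one unit on functions on `ℤ`: `(τ u) k = u (k - 1)`. -/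
def shift : (ℤ → ℂ) ≃ₗ[ℂ] (ℤ → ℂ) :=
  LinearEquiv.funCongrLeft ℂ ℂ (Equiv.subRight (1 : ℤ))

/-- The operator `p(τ) = ∑_{j = -N₋}^{N₊} a_j τ ^ j` on functions `ℤ → ℂ`. -/
def bandOp (a : ℤ → ℂ) (Nplus Nminus : ℕ) : (ℤ → ℂ) →ₗ[ℂ] (ℤ → ℂ) :=
  ∑ j ∈ Finset.Icc (-(Nminus : ℤ)) (Nplus : ℤ),
    a j • ((shift ^ j : (ℤ → ℂ) ≃ₗ[ℂ] (ℤ → ℂ)) : (ℤ → ℂ) →ₗ[ℂ] (ℤ → ℂ))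

/-- The function `p(ζ) = ∑_{j = -N₋}^{N₊} a_j ζ ^ j`. -/
def symbol (a : ℤ → ℂ) (Nplus Nminus : ℕ) (ζ : ℂ) : ℂ :=
  ∑ j ∈ Finset.Icc (-(Nminus : ℤ)) (Nplus : ℤ), a j * ζ ^ j

/-- The set `p(S¹)`. -/
def symbolCurve (a : ℤ → ℂ) (Nplus Nminus : ℕ) : Set ℂ :=
  symbol a Nplus Nminus '' Metric.sphere (0 : ℂ) 1

/-- The winding number about `z` of a continuously differentiable closed curve
`γ : [0, 2π] → ℂ` which avoids `z`: `(2πi)⁻¹ ∫_γ dw / (w - z)`. -/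
def windingNumber (γ : ℝ → ℂ) (z : ℂ) : ℂ :=
  (2 * Real.pi * Complex.I)⁻¹ * ∫ θ in (0 : ℝ)..(2 * Real.pi), deriv γ θ / (γ θ - z)

/-- The winding number about `z` of the curve `p(S¹)`, parametrized by `θ ↦ p(e^{iθ})`,
`0 ≤ θ ≤ 2π`. -/
def symbolIndex (a : ℤ → ℂ) (Nplus Nminus : ℕ) (z : ℂ) : ℂ :=
  windingNumber (fun θ : ℝ => symbol a Nplus Nminus (Complex.exp (θ * Complex.I))) z

/-- The Hilbert space `ℓ²([1, N])`, where `[1, N] = {1, …, N} ⊆ ℤ`. -/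
abbrev L2Interval (N : ℕ) : Type :=
  EuclideanSpace ℂ (Finset.Icc (1 : ℤ) (N : ℤ))

/-- The inclusion of `ℓ²([1, N])` in the functions on `ℤ` (extension by zero). -/
def extendZero (N : ℕ) : L2Interval N →ₗ[ℂ] (ℤ → ℂ) :=
  Function.ExtendByZero.linearMap ℂ (Subtype.val : Finset.Icc (1 : ℤ) (N : ℤ) → ℤ) ∘ₗ
    (WithLp.linearEquiv 2 ℂ (Finset.Icc (1 : ℤ) (N : ℤ) → ℂ)).toLinearMap

/-- Restriction of functions on `ℤ` to `[1, N]`. -/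
def restrict (N : ℕ) : (ℤ → ℂ) →ₗ[ℂ] L2Interval N :=
  (WithLp.linearEquiv 2 ℂ (Finset.Icc (1 : ℤ) (N : ℤ) → ℂ)).symm.toLinearMap ∘ₗ
    LinearMap.funLeft ℂ ℂ (Subtype.val : Finset.Icc (1 : ℤ) (N : ℤ) → ℤ)

/-- The band Toeplitz matrix `P_N = 1_{[1,N]} p(τ) 1_{[1,N]}`, as an operator on `ℓ²([1, N])`
(its norm is the operator norm). -/
def toeplitz (a : ℤ → ℂ) (Nplus Nminus N : ℕ) : L2Interval N →L[ℂ] L2Interval N :=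
  LinearMap.toContinuousLinearMap (restrict N ∘ₗ bandOp a Nplus Nminus ∘ₗ extendZero N)

end BandToeplitz

end

namespace BandToeplitz

open MeasureTheory Polynomial

/-! For fixed `z`, the argument principle turns index zero into a root count: `ζ ^ Nminus * (p(ζ) -
z)` has exactly `Nminus` roots in the open unit disc and none on the circle. Hence p(τ) - z is a
nonzero constant times factors 1 - rτ and 1 - rτ⁻¹ with |r| < 1 (`exists_wienerHopf`). On a
half-line one kind of factor preserves supports and the other only looks further into the half-line,
so each costs at most 1 - |r|. The product is thus bounded below on every half-line, uniformly in
the endpoint (`half_line_bound`).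

Two linear cutoffs summing to 1 on [1, N] reduce the interval to its two half-lines. Their
commutators with p(τ) are O(1/N), so P_N - z is bounded below for large N (`interval_bound`,
`exists_toeplitz_bound`). In finite dimension this gives the inverse and its norm; stability under
small changes of `z` and compactness of Ω make the constants uniform. -/

/-! ### The ℓ² norm on ℤ. -/

/-- Square summability of a function on `ℤ`. -/
abbrev SqSummable (f : ℤ → ℂ) : Prop := MemLp f 2 (Measure.count : Measure ℤ)

/-- The `ℓ²` norm of a function on `ℤ`. -/
noncomputable def l2norm (f : ℤ → ℂ) : ℝ := (eLpNorm f 2 (Measure.count : Measure ℤ)).toReal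

theorem l2norm_zero : l2norm 0 = 0 := by simp [l2norm]

theorem aestronglyMeasurable_count (f : ℤ → ℂ) :
    AEStronglyMeasurable f (Measure.count : Measure ℤ) :=
  (Measurable.of_discrete (f := f)).stronglyMeasurable.aestronglyMeasurable

/-- `toReal` sends ∞ to 0, so the inequality can fail without square summability; hence the
summability side conditions throughout. -/
theorem l2norm_add_le {f g : ℤ → ℂ} (hf : SqSummable f) (hg : SqSummable g) :
    l2norm (f + g) ≤ l2norm f + l2norm g := by
  unfold l2norm
  rw [← ENNReal.toReal_add hf.eLpNorm_ne_top hg.eLpNorm_ne_top]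
  exact ENNReal.toReal_mono (ENNReal.add_ne_top.2 ⟨hf.eLpNorm_ne_top, hg.eLpNorm_ne_top⟩)
    (eLpNorm_add_le hf.1 hg.1 (by norm_num))

theorem l2norm_sum_le {ι : Type*} (s : Finset ι) (f : ι → ℤ → ℂ)
    (hf : ∀ i ∈ s, SqSummable (f i)) :
    l2norm (∑ i ∈ s, f i) ≤ ∑ i ∈ s, l2norm (f i) := by
  classical
  induction s using Finset.induction_on with
  | empty => simp [l2norm_zero]
  | insert i s hi ih =>
    rw [Finset.sum_insert hi, Finset.sum_insert hi]
    have hs : ∀ j ∈ s, SqSummable (f j) := fun j hj => hf j (Finset.mem_insert_of_mem hj)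
    refine (l2norm_add_le (hf i (Finset.mem_insert_self i s)) (memLp_finsetSum' s hs)).trans ?_
    gcongr
    exact ih hs

theorem l2norm_smul (c : ℂ) (f : ℤ → ℂ) : l2norm (c • f) = ‖c‖ * l2norm f := by
  unfold l2norm
  rw [eLpNorm_const_smul, ENNReal.toReal_mul, toReal_enorm]

theorem l2norm_le_mul {f g : ℤ → ℂ} (hg : SqSummable g) {c : ℝ} (hc : 0 ≤ c)
    (h : ∀ k, ‖f k‖ ≤ c * ‖g k‖) : SqSummable f ∧ l2norm f ≤ c * l2norm g := by
  have h1 := eLpNorm_le_mul_eLpNorm_of_ae_le_mul (μ := (Measure.count : Measure ℤ))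
    (f := f) (g := g) (c := c) (Filter.Eventually.of_forall h) 2
  have h2 : ENNReal.ofReal c * eLpNorm g 2 (Measure.count : Measure ℤ) ≠ ⊤ :=
    ENNReal.mul_ne_top ENNReal.ofReal_ne_top hg.eLpNorm_ne_top
  refine ⟨⟨aestronglyMeasurable_count f, h1.trans_lt h2.lt_top⟩, ?_⟩
  have := ENNReal.toReal_mono h2 h1
  rwa [ENNReal.toReal_mul, ENNReal.toReal_ofReal hc] at this

theorem l2norm_mono {f g : ℤ → ℂ} (hg : SqSummable g) (h : ∀ k, ‖f k‖ ≤ ‖g k‖) :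
    l2norm f ≤ l2norm g := by
  simpa using (l2norm_le_mul hg zero_le_one (by simpa using h)).2

theorem eLpNorm_two_count (f : ℤ → ℂ) :
    eLpNorm f 2 (Measure.count : Measure ℤ) = (∑' k, ‖f k‖ₑ ^ (2 : ℝ)) ^ (1 / 2 : ℝ) := by
  rw [eLpNorm_eq_lintegral_rpow_enorm_toReal (by norm_num) (by norm_num), lintegral_count]
  simp

theorem eLpNorm_comp_equiv (f : ℤ → ℂ) (e : ℤ ≃ ℤ) :
    eLpNorm (f ∘ e) 2 (Measure.count : Measure ℤ) = eLpNorm f 2 Measure.count := by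
  rw [eLpNorm_two_count, eLpNorm_two_count, ← Equiv.tsum_eq e (fun k => ‖f k‖ₑ ^ (2 : ℝ))]
  rfl

theorem SqSummable.comp_equiv {f : ℤ → ℂ} (hf : SqSummable f) (e : ℤ ≃ ℤ) :
    SqSummable (f ∘ e) :=
  ⟨aestronglyMeasurable_count _, by rw [eLpNorm_comp_equiv]; exact hf.2⟩

theorem l2norm_comp_equiv (f : ℤ → ℂ) (e : ℤ ≃ ℤ) : l2norm (f ∘ e) = l2norm f := by
  rw [l2norm, eLpNorm_comp_equiv, l2norm]

theorem SqSummable.indicator' {f : ℤ → ℂ} (hf : SqSummable f) (S : Set ℤ) :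
    SqSummable (S.indicator f) :=
  MemLp.indicator (MeasurableSet.of_discrete) hf

/-! ### Pointwise formulas for translations. -/

theorem shift_apply (f : ℤ → ℂ) (k : ℤ) : shift f k = f (k - 1) := rfl

theorem shift_symm_apply (f : ℤ → ℂ) (k : ℤ) : shift.symm f k = f (k + 1) := rfl

theorem shift_zpow_apply (j : ℤ) (f : ℤ → ℂ) (k : ℤ) :
    (shift ^ j : (ℤ → ℂ) ≃ₗ[ℂ] (ℤ → ℂ)) f k = f (k - j) := by
  induction j using Int.induction_on generalizing f k with
  | zero => simp
  | succ n ih =>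
    rw [zpow_add_one, LinearEquiv.mul_apply, ih, shift_apply]
    congr 1; ring
  | pred n ih =>
    rw [zpow_sub_one, LinearEquiv.mul_apply, ih]
    change shift.symm f _ = _
    rw [shift_symm_apply]
    congr 1; ring

theorem bandOp_apply (a : ℤ → ℂ) (Nplus Nminus : ℕ) (f : ℤ → ℂ) (k : ℤ) :
    bandOp a Nplus Nminus f k =
      ∑ j ∈ Finset.Icc (-(Nminus : ℤ)) (Nplus : ℤ), a j * f (k - j) := by
  simp [bandOp, LinearMap.sum_apply, Finset.sum_apply, shift_zpow_apply]

/-! ### Lower bounds for products of factors 1 - rσ. -/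

/-- `σ` does not increase the `ℓ²` norm of the restriction to `S`. -/
structure ContractsOn (σ : Module.End ℂ (ℤ → ℂ)) (S : Set ℤ) : Prop where
  memLp : ∀ f, SqSummable f → SqSummable (σ f)
  le : ∀ f, SqSummable f → l2norm (S.indicator (σ f)) ≤ l2norm (S.indicator f)

/-- The polynomial `∏ (1 - r X)` over a multiset of numbers `r`. -/
noncomputable def revProd (s : Multiset ℂ) : ℂ[X] := (s.map fun r => 1 - C r * X).prod

theorem sqSummable_aeval {σ : Module.End ℂ (ℤ → ℂ)} {S : Set ℤ} (hσ : ContractsOn σ S)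
    (s : Multiset ℂ) {f : ℤ → ℂ} (hf : SqSummable f) :
    SqSummable (aeval σ (revProd s) f) := by
  induction s using Multiset.induction_on with
  | empty => simpa [revProd] using hf
  | cons r s ih =>
    have : aeval σ (revProd (r ::ₘ s)) f =
        aeval σ (revProd s) f - r • σ (aeval σ (revProd s) f) := by
      simp [revProd, sub_mul, Algebra.algebraMap_eq_smul_one]
    rw [this]
    exact ih.sub ((hσ.memLp _ ih).const_smul r)

theorem aeval_support {σ : Module.End ℂ (ℤ → ℂ)} {S : Set ℤ}
    (hσ : ∀ f : ℤ → ℂ, (∀ k, k ∉ S → f k = 0) → ∀ k, k ∉ S → σ f k = 0)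
    (s : Multiset ℂ) {f : ℤ → ℂ} (hf : ∀ k, k ∉ S → f k = 0) :
    ∀ k, k ∉ S → aeval σ (revProd s) f k = 0 := by
  induction s using Multiset.induction_on with
  | empty => simpa [revProd] using hf
  | cons r s ih =>
    have : aeval σ (revProd (r ::ₘ s)) f =
        aeval σ (revProd s) f - r • σ (aeval σ (revProd s) f) := by
      simp [revProd, sub_mul, Algebra.algebraMap_eq_smul_one]
    intro k hk
    simp [this, ih k hk, hσ _ ih k hk]

/-- The constant `∏ (1 - |r|)` over a multiset of numbers `r`. -/
noncomputable def revConst (s : Multiset ℂ) : ℝ := (s.map fun r => 1 - ‖r‖).prod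

theorem revConst_pos {s : Multiset ℂ} (hs : ∀ r ∈ s, ‖r‖ < 1) : 0 < revConst s := by
  refine Multiset.prod_induction (0 < ·) _ (fun _ _ => mul_pos) one_pos ?_
  intro x hx
  obtain ⟨r, hr, rfl⟩ := Multiset.mem_map.1 hx
  exact sub_pos.2 (hs r hr)

/-- One factor at a time: on S, ‖g‖ ≤ ‖g - rσg‖ + |r|‖σg‖ and ‖σg‖ ≤ ‖g‖, so each factor loses at
most 1 - |r|. -/
theorem revConst_mul_le_aeval {σ : Module.End ℂ (ℤ → ℂ)} {S : Set ℤ} (hσ : ContractsOn σ S)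
    {s : Multiset ℂ} (hs : ∀ r ∈ s, ‖r‖ < 1) {f : ℤ → ℂ} (hf : SqSummable f) :
    revConst s * l2norm (S.indicator f) ≤ l2norm (S.indicator (aeval σ (revProd s) f)) := by
  induction s using Multiset.induction_on with
  | empty => simp [revProd, revConst]
  | cons r s ih =>
    have hg := sqSummable_aeval hσ s hf
    have ih := ih fun r hr => hs r (Multiset.mem_cons_of_mem hr)
    set g := aeval σ (revProd s) f with hgdef
    have h1 : aeval σ (revProd (r ::ₘ s)) f = g - r • σ g := by
      simp [revProd, sub_mul, Algebra.algebraMap_eq_smul_one, hgdef]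
    have hr := hs r (Multiset.mem_cons_self r s)
    have hσg := hσ.memLp g hg
    have h2 : S.indicator g = S.indicator (g - r • σ g) + r • S.indicator (σ g) := by
      rw [Set.indicator_sub']
      ext k
      by_cases hk : k ∈ S <;> simp [hk]
    have h3 : l2norm (S.indicator g) ≤
        l2norm (S.indicator (g - r • σ g)) + ‖r‖ * l2norm (S.indicator g) := by
      conv_lhs => rw [h2]
      refine (l2norm_add_le (SqSummable.indicator' (hg.sub (hσg.const_smul r)) S)
        (MemLp.const_smul (SqSummable.indicator' hσg S) r)).trans ?_
      rw [l2norm_smul]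
      have := hσ.le g hg
      gcongr
    rw [h1, revConst, Multiset.map_cons, Multiset.prod_cons, mul_assoc, ← revConst]
    have : 0 ≤ 1 - ‖r‖ := (sub_pos.2 hr).le
    nlinarith [mul_le_mul_of_nonneg_left ih this]

/-! ### Half-line estimates. -/

/-- Right translation as an endomorphism. -/
noncomputable abbrev shiftEnd : Module.End ℂ (ℤ → ℂ) := shift.toLinearMap

/-- Left translation as an endomorphism. -/
noncomputable abbrev shiftInv : Module.End ℂ (ℤ → ℂ) := shift.symm.toLinearMap

theorem contractsOn_shiftEnd {S : Set ℤ} (hS : ∀ k ∈ S, k - 1 ∈ S) : ContractsOn shiftEnd S where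
  memLp f hf := hf.comp_equiv (Equiv.subRight 1)
  le f hf := by
    rw [← l2norm_comp_equiv (S.indicator f) (Equiv.subRight 1)]
    refine l2norm_mono ((hf.indicator' S).comp_equiv _) fun k => ?_
    by_cases hk : k ∈ S
    · simp [hk, hS k hk, shift_apply]
    · simp [hk]

theorem contractsOn_shiftInv {S : Set ℤ} (hS : ∀ k ∈ S, k + 1 ∈ S) : ContractsOn shiftInv S where
  memLp f hf := hf.comp_equiv (Equiv.subRight 1).symm
  le f hf := by
    rw [← l2norm_comp_equiv (S.indicator f) (Equiv.subRight 1).symm]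
    refine l2norm_mono ((hf.indicator' S).comp_equiv _) fun k => ?_
    by_cases hk : k ∈ S
    · simp [hk, hS k hk, shift_symm_apply]
    · simp [hk]

theorem commute_aeval_shift (p q : ℂ[X]) : Commute (aeval shiftEnd p) (aeval shiftInv q) := by
  have h : Commute shiftEnd shiftInv := by
    refine LinearMap.ext fun f => ?_
    simp [Module.End.mul_apply]
  have h1 : ∀ (x : Module.End ℂ (ℤ → ℂ)) (y : Module.End ℂ (ℤ → ℂ)), Commute x y →
      ∀ q : ℂ[X], Commute x (aeval y q) := by
    intro x y hxy q
    induction q using Polynomial.induction_on' with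
    | add p q hp hq => rw [map_add]; exact hp.add_right hq
    | monomial n c =>
      rw [aeval_monomial]
      exact Commute.mul_right (Algebra.commutes c x).symm (hxy.pow_right n)
  exact h1 _ _ (h1 _ _ h.symm p).symm q

/-- The order of the factors matters. The inner ρ-product keeps the support in S, so its full-line
bound is already a bound on S; the outer σ-product is then controlled by values on S alone. -/
theorem half_line_bound {σ ρ : Module.End ℂ (ℤ → ℂ)} {S : Set ℤ} (hσ : ContractsOn σ S)
    (hρ : ContractsOn ρ Set.univ)
    (hρS : ∀ f : ℤ → ℂ, (∀ k, k ∉ S → f k = 0) → ∀ k, k ∉ S → ρ f k = 0)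
    {s t : Multiset ℂ} (hs : ∀ r ∈ s, ‖r‖ < 1) (ht : ∀ r ∈ t, ‖r‖ < 1)
    {f : ℤ → ℂ} (hf : SqSummable f) (hfS : ∀ k, k ∉ S → f k = 0) :
    revConst s * revConst t * l2norm f ≤
      l2norm (S.indicator ((aeval σ (revProd s) * aeval ρ (revProd t)) f)) := by
  have h1 := revConst_mul_le_aeval hρ ht hf
  rw [Set.indicator_univ, Set.indicator_univ] at h1
  have h2 := revConst_mul_le_aeval hσ hs (sqSummable_aeval hρ t hf)
  have h3 : S.indicator (aeval ρ (revProd t) f) = aeval ρ (revProd t) f := by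
    refine Set.indicator_eq_self.2 fun k hk => ?_
    by_contra hkS
    exact hk (aeval_support hρS t hfS k hkS)
  rw [h3] at h2
  rw [Module.End.mul_apply, mul_assoc]
  exact (mul_le_mul_of_nonneg_left h1 (revConst_pos hs).le).trans h2

/-- An operator with a Wiener–Hopf factorization is bounded below on right half-lines. -/
theorem half_line_bound_Ici {s t : Multiset ℂ} (hs : ∀ r ∈ s, ‖r‖ < 1) (ht : ∀ r ∈ t, ‖r‖ < 1)
    (n : ℤ) {f : ℤ → ℂ} (hf : SqSummable f) (hfS : ∀ k, k ∉ Set.Ici n → f k = 0) :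
    revConst s * revConst t * l2norm f ≤ l2norm ((Set.Ici n).indicator
      ((aeval shiftEnd (revProd s) * aeval shiftInv (revProd t)) f)) := by
  -- On a right half-line τ preserves supports and τ⁻¹ contracts, so the τ⁻¹-factors must stand
  -- outermost.
  rw [(commute_aeval_shift _ _).eq, mul_comm (revConst s)]
  refine half_line_bound (contractsOn_shiftInv fun k hk => ?_)
    (contractsOn_shiftEnd fun k hk => trivial) (fun f hf k hk => hf _ ?_) ht hs hf hfS
  · simp only [Set.mem_Ici] at *; omega
  · simp only [Set.mem_Ici, Equiv.subRight_apply] at *; omega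

/-- An operator with a Wiener–Hopf factorization is bounded below on left half-lines. -/
theorem half_line_bound_Iic {s t : Multiset ℂ} (hs : ∀ r ∈ s, ‖r‖ < 1) (ht : ∀ r ∈ t, ‖r‖ < 1)
    (n : ℤ) {f : ℤ → ℂ} (hf : SqSummable f) (hfS : ∀ k, k ∉ Set.Iic n → f k = 0) :
    revConst s * revConst t * l2norm f ≤ l2norm ((Set.Iic n).indicator
      ((aeval shiftEnd (revProd s) * aeval shiftInv (revProd t)) f)) := by
  refine half_line_bound (contractsOn_shiftEnd fun k hk => ?_)
    (contractsOn_shiftInv fun k hk => trivial) (fun f hf k hk => hf _ ?_) hs ht hf hfS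
  · simp only [Set.mem_Iic] at *; omega
  · change k + 1 ∉ _
    simp only [Set.mem_Iic] at *; omega

/-! ### Cutoffs: from half-lines to intervals. -/

/-- The `z` term commutes with χ, and the jth translation contributes the difference χ(k - j) -
χ(k), of size at most ε|j|. -/
theorem l2norm_commutator_le (a : ℤ → ℂ) (Nplus Nminus : ℕ) (z : ℂ) {χ : ℤ → ℝ} {ε : ℝ}
    (hε : 0 ≤ ε) (hχ : ∀ k l, |χ k - χ l| ≤ ε * |(k : ℝ) - l|) {f : ℤ → ℂ} (hf : SqSummable f) :
    SqSummable ((bandOp a Nplus Nminus - z • 1) (fun k => χ k * f k) -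
      fun k => χ k * (bandOp a Nplus Nminus - z • 1) f k) ∧
    l2norm ((bandOp a Nplus Nminus - z • 1) (fun k => χ k * f k) -
      fun k => χ k * (bandOp a Nplus Nminus - z • 1) f k) ≤
      ε * (∑ j ∈ Finset.Icc (-(Nminus : ℤ)) (Nplus : ℤ), ‖a j‖ * |(j : ℝ)|) * l2norm f := by
  have h1 : (bandOp a Nplus Nminus - z • 1) (fun k => χ k * f k) -
      (fun k => χ k * (bandOp a Nplus Nminus - z • 1) f k) =
      ∑ j ∈ Finset.Icc (-(Nminus : ℤ)) (Nplus : ℤ),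
        fun k => a j * ((χ (k - j) - χ k : ℝ) : ℂ) * f (k - j) := by
    ext k
    simp only [LinearMap.sub_apply, LinearMap.smul_apply, Module.End.one_apply, Pi.sub_apply,
      Pi.smul_apply, smul_eq_mul, bandOp_apply, Finset.sum_apply, mul_sub, Finset.mul_sum]
    rw [show ∀ x y u v : ℂ, u = v → x - u - (y - v) = x - y from fun x y u v h => by rw [h]; ring,
      ← Finset.sum_sub_distrib]
    · refine Finset.sum_congr rfl fun j _ => ?_
      push_cast; ring
    · ring
  have h2 : ∀ j : ℤ, SqSummable (fun k => a j * ((χ (k - j) - χ k : ℝ) : ℂ) * f (k - j)) ∧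
      l2norm (fun k => a j * ((χ (k - j) - χ k : ℝ) : ℂ) * f (k - j)) ≤
        ε * (‖a j‖ * |(j : ℝ)|) * l2norm f := by
    intro j
    rw [← l2norm_comp_equiv f (Equiv.subRight j)]
    refine l2norm_le_mul (hf.comp_equiv _) (by positivity) fun k => ?_
    rw [norm_mul, norm_mul, Complex.norm_real, Real.norm_eq_abs]
    have := hχ (k - j) k
    have h3 : |((k - j : ℤ) : ℝ) - k| = |(j : ℝ)| := by
      rw [← abs_neg (j : ℝ)]; congr 1; push_cast; ring
    rw [h3] at this
    simp only [Function.comp_apply, Equiv.subRight_apply]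
    calc ‖a j‖ * |χ (k - j) - χ k| * ‖f (k - j)‖
        ≤ ‖a j‖ * (ε * |(j : ℝ)|) * ‖f (k - j)‖ := by gcongr
      _ = _ := by ring
  rw [h1]
  refine ⟨memLp_finsetSum' _ fun j _ => (h2 j).1, (l2norm_sum_le _ _ fun j _ => (h2 j).1).trans ?_⟩
  rw [Finset.mul_sum, Finset.sum_mul]
  exact Finset.sum_le_sum fun j _ => (h2 j).2

/-- Localization to a half-line by a Lipschitz cutoff. -/
theorem cutoff_bound (a : ℤ → ℂ) (Nplus Nminus : ℕ) (z : ℂ) {χ : ℤ → ℝ} {ε m : ℝ}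
    (hε : 0 ≤ ε) (hχ : ∀ k l, |χ k - χ l| ≤ ε * |(k : ℝ) - l|) {S J : Set ℤ} (hJS : J ⊆ S)
    (hχJ : ∀ k ∈ J, |χ k| ≤ 1) (hχS : ∀ k ∈ S, k ∉ J → χ k = 0)
    (hm : ∀ f, SqSummable f → (∀ k, k ∉ S → f k = 0) →
      m * l2norm f ≤ l2norm (S.indicator ((bandOp a Nplus Nminus - z • 1) f)))
    {f : ℤ → ℂ} (hf : SqSummable f) (hfJ : ∀ k, k ∉ J → f k = 0)
    (hBf : SqSummable ((bandOp a Nplus Nminus - z • 1) f)) :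
    m * l2norm (fun k => χ k * f k) ≤
      l2norm (J.indicator ((bandOp a Nplus Nminus - z • 1) f)) +
      ε * (∑ j ∈ Finset.Icc (-(Nminus : ℤ)) (Nplus : ℤ), ‖a j‖ * |(j : ℝ)|) * l2norm f := by
  obtain ⟨h1, h2⟩ := l2norm_commutator_le a Nplus Nminus z hε hχ hf
  set B := bandOp a Nplus Nminus - z • 1
  have h3 : SqSummable (fun k => χ k * f k) := by
    refine (l2norm_le_mul hf zero_le_one fun k => ?_).1
    by_cases hk : k ∈ J
    · rw [norm_mul, Complex.norm_real]
      gcongr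
      exact hχJ k hk
    · simp [hfJ k hk]
  have h4 := hm _ h3 fun k hk => by simp [hfJ k fun h => hk (hJS h)]
  have h5 : S.indicator (B fun k => χ k * f k) =
      S.indicator (fun k => χ k * B f k) +
        S.indicator ((B fun k => χ k * f k) - fun k => χ k * B f k) := by
    ext k
    by_cases hk : k ∈ S <;> simp [hk]
  -- Since χ vanishes on S \ J, the uncontrolled values of `B f` outside J do not enter.
  have h6 : SqSummable (S.indicator fun k => χ k * B f k) ∧
      l2norm (S.indicator fun k => χ k * B f k) ≤ 1 * l2norm (J.indicator (B f)) := by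
    refine l2norm_le_mul (hBf.indicator' J) zero_le_one fun k => ?_
    by_cases hk : k ∈ J
    · simp only [Set.indicator_of_mem (hJS hk), Set.indicator_of_mem hk, norm_mul,
        Complex.norm_real]
      gcongr
      exact hχJ k hk
    · by_cases hkS : k ∈ S
      · simp [hk, hkS, hχS k hkS hk]
      · simp [hk, hkS]
  rw [h5] at h4
  refine h4.trans ((l2norm_add_le h6.1 (h1.indicator' S)).trans (add_le_add ?_ ?_))
  · simpa using h6.2
  · refine le_trans (l2norm_mono h1 fun k => ?_) h2
    exact norm_indicator_le_norm_self _ _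

theorem sqSummable_bandOp_sub (a : ℤ → ℂ) (Nplus Nminus : ℕ) (z : ℂ) {f : ℤ → ℂ}
    (hf : SqSummable f) : SqSummable ((bandOp a Nplus Nminus - z • 1) f) := by
  have h : (bandOp a Nplus Nminus - z • 1) f =
      (∑ j ∈ Finset.Icc (-(Nminus : ℤ)) (Nplus : ℤ), a j • (f ∘ Equiv.subRight j)) - z • f := by
    ext k
    simp [bandOp_apply]
  rw [h]
  exact (memLp_finsetSum' _ fun j _ => (hf.comp_equiv _).const_smul _).sub (hf.const_smul z)

/-- Bounds from below on both half-lines give a bound from below on long intervals. -/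
theorem interval_bound (a : ℤ → ℂ) (Nplus Nminus : ℕ) (z : ℂ) {m : ℝ}
    (hright : ∀ f, SqSummable f → (∀ k, k ∉ Set.Ici (1 : ℤ) → f k = 0) →
      m * l2norm f ≤ l2norm ((Set.Ici (1 : ℤ)).indicator ((bandOp a Nplus Nminus - z • 1) f)))
    (hleft : ∀ n : ℤ, ∀ f, SqSummable f → (∀ k, k ∉ Set.Iic n → f k = 0) →
      m * l2norm f ≤ l2norm ((Set.Iic n).indicator ((bandOp a Nplus Nminus - z • 1) f)))
    {N : ℕ} (hN : 0 < N) (hm : 0 ≤ m)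
    {f : ℤ → ℂ} (hf : SqSummable f) (hfJ : ∀ k, k ∉ Set.Icc (1 : ℤ) N → f k = 0) :
    m * l2norm f ≤
      2 * (l2norm ((Set.Icc (1 : ℤ) N).indicator ((bandOp a Nplus Nminus - z • 1) f)) +
      (N : ℝ)⁻¹ * (∑ j ∈ Finset.Icc (-(Nminus : ℤ)) (Nplus : ℤ), ‖a j‖ * |(j : ℝ)|) *
        l2norm f) := by
  have hN' : (0 : ℝ) < N := by exact_mod_cast hN
  have hBf := sqSummable_bandOp_sub a Nplus Nminus z hf
  have hlip : ∀ x y : ℝ, |max 0 x - max 0 y| ≤ |x - y| := fun x y => by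
    simpa using abs_max_sub_max_le_max 0 x 0 y
  -- The decreasing cutoff vanishes from N on, which leaves only the left endpoint of [1, N].
  have hr := cutoff_bound a Nplus Nminus z (χ := fun k => max 0 (1 - k / N)) (ε := (N : ℝ)⁻¹)
    (inv_nonneg.2 hN'.le) (fun k l => (hlip _ _).trans (le_of_eq (by
      rw [show (1 - (k : ℝ) / N) - (1 - (l : ℝ) / N) = (N : ℝ)⁻¹ * -((k : ℝ) - l) by
        field_simp; ring, abs_mul, abs_neg, abs_of_pos (inv_pos.2 hN')])))
    (S := Set.Ici 1) (J := Set.Icc 1 (N : ℤ)) (fun k hk => hk.1) (fun k hk => by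
      have h1 : (1 : ℝ) ≤ k := by exact_mod_cast hk.1
      have : 0 ≤ (k : ℝ) / N := by positivity
      rw [abs_of_nonneg (le_max_left _ _)]
      exact max_le zero_le_one (by linarith)) (fun k hk hk' => by
      refine max_eq_left ?_
      have h1 : (N : ℤ) ≤ k := by
        by_contra h
        exact hk' ⟨hk, by omega⟩
      have h2 : (N : ℝ) ≤ k := by exact_mod_cast h1
      have : 1 ≤ (k : ℝ) / N := by rwa [le_div_iff₀ hN', one_mul]
      linarith) hright hf hfJ hBf
  -- The increasing cutoff vanishes up to 0, which leaves only the right endpoint.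
  have hl := cutoff_bound a Nplus Nminus z (χ := fun k => max 0 (k / N)) (ε := (N : ℝ)⁻¹)
    (inv_nonneg.2 hN'.le) (fun k l => (hlip _ _).trans (le_of_eq (by
      rw [show ((k : ℝ) / N) - ((l : ℝ) / N) = (N : ℝ)⁻¹ * ((k : ℝ) - l) by
        field_simp, abs_mul, abs_of_pos (inv_pos.2 hN')])))
    (S := Set.Iic (N : ℤ)) (J := Set.Icc 1 (N : ℤ)) (fun k hk => hk.2) (fun k hk => by
      have h1 : (k : ℝ) ≤ N := by exact_mod_cast hk.2
      rw [abs_of_nonneg (le_max_left _ _)]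
      exact max_le zero_le_one (by rwa [div_le_iff₀ hN', one_mul])) (fun k hk hk' => by
      refine max_eq_left ?_
      have h1 : k ≤ 0 := by
        by_contra h
        exact hk' ⟨by omega, hk⟩
      have h2 : (k : ℝ) ≤ 0 := by exact_mod_cast h1
      exact div_nonpos_of_nonpos_of_nonneg h2 hN'.le) (hleft N) hf hfJ hBf
  have hsum : f = (fun k : ℤ => ((max 0 (1 - k / N) : ℝ) : ℂ) * f k) +
      fun k : ℤ => ((max 0 (k / N) : ℝ) : ℂ) * f k := by
    ext k
    by_cases hk : k ∈ Set.Icc (1 : ℤ) N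
    · have h1 : (1 : ℝ) ≤ k := by exact_mod_cast hk.1
      have h2 : (k : ℝ) ≤ N := by exact_mod_cast hk.2
      have h3 : 0 ≤ (k : ℝ) / N := by positivity
      have h4 : (k : ℝ) / N ≤ 1 := by rwa [div_le_iff₀ hN', one_mul]
      rw [Pi.add_apply, max_eq_right h3, max_eq_right (by linarith)]
      push_cast; ring
    · simp [hfJ k hk]
  have hsq : ∀ χ : ℤ → ℝ, (∀ k ∈ Set.Icc (1 : ℤ) N, |χ k| ≤ 1) →
      SqSummable (fun k => (χ k : ℂ) * f k) := fun χ hχ => by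
    refine (l2norm_le_mul hf zero_le_one fun k => ?_).1
    by_cases hk : k ∈ Set.Icc (1 : ℤ) N
    · rw [norm_mul, Complex.norm_real]
      gcongr
      exact hχ k hk
    · simp [hfJ k hk]
  have htri : l2norm f ≤ l2norm (fun k : ℤ => ((max 0 (1 - k / N) : ℝ) : ℂ) * f k) +
      l2norm (fun k : ℤ => ((max 0 (k / N) : ℝ) : ℂ) * f k) := by
    conv_lhs => rw [hsum]
    refine l2norm_add_le (hsq _ fun k hk => ?_) (hsq _ fun k hk => ?_)
    · have h1 : (1 : ℝ) ≤ k := by exact_mod_cast hk.1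
      have : 0 ≤ (k : ℝ) / N := by positivity
      rw [abs_of_nonneg (le_max_left _ _)]
      exact max_le zero_le_one (by linarith)
    · have h1 : (k : ℝ) ≤ N := by exact_mod_cast hk.2
      rw [abs_of_nonneg (le_max_left _ _)]
      exact max_le zero_le_one (by rwa [div_le_iff₀ hN', one_mul])
  calc m * l2norm f ≤ m * (l2norm (fun k : ℤ => ((max 0 (1 - k / N) : ℝ) : ℂ) * f k) +
      l2norm (fun k : ℤ => ((max 0 (k / N) : ℝ) : ℂ) * f k)) := by gcongr
    _ ≤ _ := by linarith

/-! ### The symbol polynomial and its linear factors. -/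

/-- The polynomial `ζ ^ Nminus * (p(ζ) - z)`. -/
noncomputable def symbolPoly (a : ℤ → ℂ) (Nplus Nminus : ℕ) (z : ℂ) : ℂ[X] :=
  ∑ j ∈ Finset.Icc (-(Nminus : ℤ)) (Nplus : ℤ), C (a j) * X ^ (j + Nminus).toNat -
    C z * X ^ Nminus

theorem eval_symbolPoly (a : ℤ → ℂ) (Nplus Nminus : ℕ) (z : ℂ) {ζ : ℂ} (hζ : ζ ≠ 0) :
    (symbolPoly a Nplus Nminus z).eval ζ = ζ ^ Nminus * (symbol a Nplus Nminus ζ - z) := by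
  simp only [symbolPoly, symbol, eval_sub, eval_finsetSum, eval_mul, eval_C, eval_pow, eval_X,
    mul_sub, Finset.mul_sum]
  congr 1
  · refine Finset.sum_congr rfl fun j hj => ?_
    have h : ζ ^ (j + Nminus).toNat = ζ ^ j * ζ ^ Nminus := by
      rw [← zpow_natCast, Int.toNat_of_nonneg (by have := (Finset.mem_Icc.1 hj).1; omega),
        zpow_add₀ hζ, zpow_natCast]
    rw [h]; ring
  · ring

theorem shiftEnd_pow_apply (n : ℕ) (f : ℤ → ℂ) (k : ℤ) : (shiftEnd ^ n) f k = f (k - n) := by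
  induction n generalizing k with
  | zero => simp
  | succ n ih =>
    rw [pow_succ', Module.End.mul_apply]
    change (shiftEnd ^ n) f (k - 1) = _
    rw [ih]
    congr 1; push_cast; ring

/-- Carries factorizations of the polynomial over to the operator; the power of τ clears the
negative exponents. -/
theorem aeval_symbolPoly (a : ℤ → ℂ) (Nplus Nminus : ℕ) (z : ℂ) :
    aeval shiftEnd (symbolPoly a Nplus Nminus z) =
      shiftEnd ^ Nminus * (bandOp a Nplus Nminus - z • 1) := by
  refine LinearMap.ext fun f => funext fun k => ?_
  simp only [symbolPoly, map_sub, map_sum, map_mul, aeval_C, aeval_X, map_pow,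
    Algebra.algebraMap_eq_smul_one, smul_mul_assoc, one_mul, LinearMap.sub_apply,
    LinearMap.sum_apply, Pi.sub_apply, Finset.sum_apply, LinearMap.smul_apply, Pi.smul_apply,
    shiftEnd_pow_apply, Module.End.mul_apply, bandOp_apply, Module.End.one_apply, smul_eq_mul]
  congr 1
  refine Finset.sum_congr rfl fun j hj => ?_
  rw [Int.toNat_of_nonneg (by have := (Finset.mem_Icc.1 hj).1; omega)]
  congr 2; ring

theorem shiftEnd_mul_shiftInv : shiftEnd * shiftInv = 1 := by
  refine LinearMap.ext fun f => ?_
  simp [Module.End.mul_apply]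

theorem shiftInv_mul_shiftEnd : shiftInv * shiftEnd = 1 := by
  refine LinearMap.ext fun f => ?_
  simp [Module.End.mul_apply]

/-- Used for roots inside the disc: τ - r = τ(1 - rτ⁻¹), and the powers of τ are collected in front.
-/
theorem aeval_prod_X_sub_C (s : Multiset ℂ) :
    aeval shiftEnd (s.map fun r => X - C r).prod =
      shiftEnd ^ Multiset.card s * aeval shiftInv (revProd s) := by
  induction s using Multiset.induction_on with
  | empty => simp [revProd]
  | cons r s ih =>
    have h1 : aeval shiftEnd (X - C r) = shiftEnd * aeval shiftInv (1 - C r * X) := by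
      simp only [map_sub, aeval_X, aeval_C, map_one, map_mul, mul_sub, mul_one]
      rw [Algebra.commutes, ← mul_assoc, shiftEnd_mul_shiftInv, one_mul]
    have h2 := (commute_aeval_shift (X ^ Multiset.card s) (1 - C r * X)).eq
    rw [aeval_X_pow] at h2
    have h3 : revProd (r ::ₘ s) = (1 - C r * X) * revProd s := by simp [revProd]
    rw [Multiset.map_cons, Multiset.prod_cons, map_mul, ih, h1, Multiset.card_cons, h3, map_mul,
      pow_succ']
    simp only [mul_assoc]
    rw [← mul_assoc _ (shiftEnd ^ _), ← h2, mul_assoc]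

/-- Used for roots outside the disc: X - r = -r(1 - r⁻¹X), with r⁻¹ inside. -/
theorem prod_X_sub_C_eq_revProd (s : Multiset ℂ) (hs : ∀ r ∈ s, r ≠ 0) :
    (s.map fun r => X - C r).prod =
      C (s.map fun r => -r).prod * revProd (s.map fun r => r⁻¹) := by
  induction s using Multiset.induction_on with
  | empty => simp [revProd]
  | cons r s ih =>
    have hr := hs r (Multiset.mem_cons_self r s)
    have h1 : (X - C r : ℂ[X]) = C (-r) * (1 - C r⁻¹ * X) := by
      rw [mul_sub, ← mul_assoc, ← C_mul, neg_mul, mul_inv_cancel₀ hr]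
      simp only [map_neg, map_one, mul_one]; ring
    simp only [Multiset.map_cons, Multiset.prod_cons, map_mul, revProd,
      ih fun r hr => hs r (Multiset.mem_cons_of_mem hr)]
    rw [h1]; ring

/-! ### The argument principle. -/

theorem circleIntegral_sum_inv (s : Multiset ℂ) (hs : ∀ r ∈ s, ‖r‖ ≠ 1) :
    CircleIntegrable (fun ζ => (s.map fun r => 1 / (ζ - r)).sum) 0 1 ∧
    ∮ ζ in C(0, 1), (s.map fun r => 1 / (ζ - r)).sum =
      2 * Real.pi * Complex.I * (Multiset.card (s.filter fun r => ‖r‖ < 1) : ℂ) := by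
  induction s using Multiset.induction_on with
  | empty => simp [circleIntegral]
  | cons r s ih =>
    obtain ⟨h1, h2⟩ := ih fun r hr => hs r (Multiset.mem_cons_of_mem hr)
    have hr := hs r (Multiset.mem_cons_self r s)
    have h3 : CircleIntegrable (fun ζ => 1 / (ζ - r)) 0 1 := by
      refine ContinuousOn.circleIntegrable zero_le_one ?_
      refine continuousOn_const.div (by fun_prop) fun ζ hζ h => hr ?_
      rw [← sub_eq_zero.1 h]
      simpa using hζ
    simp only [Multiset.map_cons, Multiset.sum_cons]
    refine ⟨h3.add h1, ?_⟩
    rw [circleIntegral.integral_add h3 h1, h2]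
    by_cases hlt : ‖r‖ < 1
    · rw [Multiset.filter_cons_of_pos (p := fun r => ‖r‖ < 1) s hlt, Multiset.card_cons]
      simp only [one_div]
      rw [circleIntegral.integral_sub_inv_of_mem_ball (by simpa using hlt)]
      push_cast; ring
    · rw [Multiset.filter_cons_of_neg (p := fun r => ‖r‖ < 1) s hlt]
      rw [DiffContOnCl.circleIntegral_eq_zero zero_le_one, zero_add]
      have h4 : 1 < ‖r‖ := lt_of_le_of_ne (not_lt.1 hlt) (Ne.symm hr)
      refine DifferentiableOn.diffContOnCl fun ζ hζ => ?_
      refine ((differentiableAt_const _).div (by fun_prop) fun h => ?_).differentiableWithinAt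
      have h5 := Metric.closure_ball_subset_closedBall hζ
      rw [sub_eq_zero.1 h] at h5
      simp only [mem_closedBall_zero_iff] at h5
      linarith

/-- The argument principle for the symbol. -/
theorem symbolIndex_eq (a : ℤ → ℂ) (Nplus Nminus : ℕ) {z : ℂ}
    (hz : z ∉ symbolCurve a Nplus Nminus) :
    symbolIndex a Nplus Nminus z =
      (Multiset.card ((symbolPoly a Nplus Nminus z).roots.filter fun r => ‖r‖ < 1) : ℂ) -
        Nminus := by
  set Q := symbolPoly a Nplus Nminus z with hQ
  have hne : ∀ ζ : ℂ, ‖ζ‖ = 1 → Q.eval ζ ≠ 0 := fun ζ hζ h => by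
    have hζ0 : ζ ≠ 0 := by rintro rfl; simp at hζ
    rw [hQ, eval_symbolPoly _ _ _ _ hζ0, mul_eq_zero, sub_eq_zero] at h
    exact hz ⟨ζ, by simpa using hζ, h.resolve_left (pow_ne_zero _ hζ0)⟩
  have hroots : ∀ r ∈ Q.roots, ‖r‖ ≠ 1 := fun r hr h => hne r h (isRoot_of_mem_roots hr)
  obtain ⟨hint, hval⟩ := circleIntegral_sum_inv Q.roots hroots
  have hsym : (fun θ : ℝ => symbol a Nplus Nminus (Complex.exp (θ * Complex.I))) =
      fun θ : ℝ => (Complex.exp (θ * Complex.I) ^ Nminus)⁻¹ *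
        Q.eval (Complex.exp (θ * Complex.I)) + z := by
    funext θ
    rw [hQ, eval_symbolPoly _ _ _ _ (Complex.exp_ne_zero _), inv_mul_cancel_left₀
      (pow_ne_zero _ (Complex.exp_ne_zero _)), sub_add_cancel]
  -- Logarithmic derivative of p - z = ζ^(-Nminus) Q: the power gives the constant term, Q the sum
  -- over its roots.
  have hintegrand : ∀ θ : ℝ,
      deriv (fun θ : ℝ => symbol a Nplus Nminus (Complex.exp (θ * Complex.I))) θ /
        (symbol a Nplus Nminus (Complex.exp (θ * Complex.I)) - z) =
      -(Nminus * Complex.I) + deriv (circleMap 0 1) θ •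
        (Q.roots.map fun r => 1 / (circleMap 0 1 θ - r)).sum := by
    intro θ
    have hcm : circleMap 0 1 θ = Complex.exp (θ * Complex.I) := by simp [circleMap]
    have hexp : HasDerivAt (fun θ : ℝ => Complex.exp (θ * Complex.I))
        (Complex.exp (θ * Complex.I) * Complex.I) θ := by
      have := hasDerivAt_circleMap 0 1 θ
      rw [hcm] at this
      convert this using 1
      funext t; simp [circleMap]
    set ζ := Complex.exp (θ * Complex.I) with hζ
    have hζ0 : ζ ≠ 0 := Complex.exp_ne_zero _
    have hQζ : Q.eval ζ ≠ 0 := hne ζ (Complex.norm_exp_ofReal_mul_I θ)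
    have hpow := ((hexp.pow Nminus).inv (pow_ne_zero _ hζ0)).mul
      ((Q.hasDerivAt ζ).comp θ hexp)
    have hd := (hpow.add_const z).deriv
    have hval := congrFun hsym θ
    simp only [← hζ] at hval
    rw [hval, hsym]
    rw [show deriv (fun θ : ℝ => (Complex.exp (θ * Complex.I) ^ Nminus)⁻¹ *
        Q.eval (Complex.exp (θ * Complex.I)) + z) θ = _ from hd]
    rw [deriv_circleMap, hcm, ← (IsAlgClosed.splits Q).eval_derivative_div_eval_of_ne_zero hQζ]
    -- Division by ζ replaces the truncated exponent and covers `Nminus = 0` too.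
    have hN : (Nminus : ℂ) * ζ ^ (Nminus - 1) = Nminus * ζ ^ Nminus / ζ := by
      cases Nminus with
      | zero => simp
      | succ n => rw [pow_succ, Nat.add_sub_cancel]; field_simp
    simp only [← hζ, Pi.inv_apply, Pi.pow_apply, Function.comp_apply, hN, smul_eq_mul,
      add_sub_cancel_right]
    field_simp
  rw [symbolIndex, windingNumber]
  simp only [hintegrand]
  rw [intervalIntegral.integral_add intervalIntegrable_const hint.out]
  change _ * (_ + ∮ ζ in C(0, 1), (Q.roots.map fun r => 1 / (ζ - r)).sum) = _
  rw [hval, intervalIntegral.integral_const]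
  have hpi : (Real.pi : ℂ) ≠ 0 := by exact_mod_cast Real.pi_ne_zero
  rw [Complex.real_smul]
  push_cast
  field_simp
  ring

/-! ### Wiener–Hopf factorization. -/

/-- Index zero means that the number of roots in the disc equals `Nminus`. The power of τ they
produce is therefore exactly the one that cleared the negative exponents, and the two cancel. -/
theorem exists_wienerHopf (a : ℤ → ℂ) (Nplus Nminus : ℕ) {z : ℂ}
    (hz : z ∉ symbolCurve a Nplus Nminus) (hind : symbolIndex a Nplus Nminus z = 0) :
    ∃ c : ℂ, c ≠ 0 ∧ ∃ s t : Multiset ℂ, (∀ r ∈ s, ‖r‖ < 1) ∧ (∀ r ∈ t, ‖r‖ < 1) ∧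
      bandOp a Nplus Nminus - z • 1 =
        c • (aeval shiftEnd (revProd s) * aeval shiftInv (revProd t)) := by
  rw [symbolIndex_eq a Nplus Nminus hz] at hind
  have hQ := aeval_symbolPoly a Nplus Nminus z
  have hne : ∀ ζ : ℂ, ‖ζ‖ = 1 → (symbolPoly a Nplus Nminus z).eval ζ ≠ 0 := fun ζ hζ h => by
    have hζ0 : ζ ≠ 0 := by rintro rfl; simp at hζ
    rw [eval_symbolPoly _ _ _ _ hζ0, mul_eq_zero, sub_eq_zero] at h
    exact hz ⟨ζ, by simpa using hζ, h.resolve_left (pow_ne_zero _ hζ0)⟩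
  set Q := symbolPoly a Nplus Nminus z
  have hQ0 : Q ≠ 0 := fun h => hne 1 (by simp) (by simp [h])
  set t := Q.roots.filter fun r => ‖r‖ < 1 with ht
  set u := Q.roots.filter fun r => ¬ ‖r‖ < 1 with hu
  have hcard : Multiset.card t = Nminus := by exact_mod_cast sub_eq_zero.1 hind
  have hu1 : ∀ r ∈ u, 1 < ‖r‖ := fun r hr => by
    obtain ⟨h1, h2⟩ := Multiset.mem_filter.1 hr
    exact lt_of_le_of_ne (not_lt.1 h2) fun h => hne r h.symm (isRoot_of_mem_roots h1)
  have hu0 : ∀ r ∈ u, r ≠ 0 := fun r hr h => by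
    have := hu1 r hr
    rw [h, norm_zero] at this
    linarith
  refine ⟨Q.leadingCoeff * (u.map fun r => -r).prod, mul_ne_zero (leadingCoeff_ne_zero.2 hQ0) ?_,
    u.map fun r => r⁻¹, t, ?_, fun r hr => (Multiset.mem_filter.1 hr).2, ?_⟩
  · refine Multiset.prod_ne_zero fun h => ?_
    obtain ⟨r, hr, h⟩ := Multiset.mem_map.1 h
    exact hu0 r hr (neg_eq_zero.1 h)
  · intro r hr
    obtain ⟨r', hr', rfl⟩ := Multiset.mem_map.1 hr
    rw [norm_inv]
    exact inv_lt_one_of_one_lt₀ (hu1 r' hr')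
  have hfac : Q = C (Q.leadingCoeff * (u.map fun r => -r).prod) *
      revProd (u.map fun r => r⁻¹) * (t.map fun r => X - C r).prod := by
    conv_lhs => rw [(IsAlgClosed.splits Q).eq_prod_roots,
      ← Multiset.filter_add_not (fun r => ‖r‖ < 1) Q.roots, Multiset.map_add, Multiset.prod_add,
      ← ht, ← hu, prod_X_sub_C_eq_revProd u hu0]
    rw [C_mul]; ring
  have hinv : shiftInv ^ Nminus * shiftEnd ^ Nminus = 1 := by
    rw [← (show Commute shiftInv shiftEnd from
      shiftInv_mul_shiftEnd.trans shiftEnd_mul_shiftInv.symm).mul_pow, shiftInv_mul_shiftEnd,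
      one_pow]
  generalize Q.leadingCoeff * (u.map fun r => -r).prod = c at hfac
  rw [hfac, map_mul, map_mul, aeval_C, aeval_prod_X_sub_C, hcard,
    Algebra.algebraMap_eq_smul_one, smul_mul_assoc, one_mul, smul_mul_assoc, ← mul_assoc] at hQ
  have hcomm : aeval shiftEnd (revProd (u.map fun r => r⁻¹)) * shiftEnd ^ Nminus =
      shiftEnd ^ Nminus * aeval shiftEnd (revProd (u.map fun r => r⁻¹)) := by
    rw [← aeval_X_pow (R := ℂ), ← map_mul, ← map_mul, mul_comm]
  rw [hcomm, mul_assoc] at hQ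
  have h := congrArg (shiftInv ^ Nminus * ·) hQ
  simp only [mul_smul_comm] at h
  rw [← mul_assoc, hinv, one_mul, ← mul_assoc, hinv, one_mul] at h
  exact h.symm

/-! ### Finite Toeplitz matrices. -/

theorem extendZero_apply_of_mem {N : ℕ} (u : L2Interval N) {k : ℤ}
    (hk : k ∈ Finset.Icc (1 : ℤ) (N : ℤ)) : extendZero N u k = u ⟨k, hk⟩ :=
  Subtype.val_injective.extend_apply u.ofLp (0 : ℤ → ℂ) ⟨k, hk⟩

theorem extendZero_apply_of_notMem {N : ℕ} (u : L2Interval N) {k : ℤ}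
    (hk : k ∉ Set.Icc (1 : ℤ) (N : ℤ)) : extendZero N u k = 0 :=
  Function.extend_apply' u.ofLp (0 : ℤ → ℂ) k fun ⟨x, hx⟩ => hk (hx ▸ Finset.mem_Icc.1 x.2)

theorem eLpNorm_extendZero {N : ℕ} (u : L2Interval N) :
    eLpNorm (extendZero N u) 2 (Measure.count : Measure ℤ) = ‖u‖ₑ := by
  rw [eLpNorm_two_count, tsum_eq_sum (s := Finset.Icc (1 : ℤ) (N : ℤ)) fun k hk => by
    rw [extendZero_apply_of_notMem u fun h => hk (Finset.mem_Icc.2 h)]; simp]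
  rw [← ofReal_norm, EuclideanSpace.norm_eq, ← Finset.sum_coe_sort, Real.sqrt_eq_rpow,
    ← ENNReal.ofReal_rpow_of_nonneg (by positivity) (by positivity),
    ENNReal.ofReal_sum_of_nonneg fun i _ => by positivity]
  congr 1
  refine Finset.sum_congr rfl fun i _ => ?_
  rw [extendZero_apply_of_mem u i.2, ← ofReal_norm,
    ENNReal.ofReal_rpow_of_nonneg (norm_nonneg _) (by norm_num)]
  norm_num

theorem sqSummable_extendZero {N : ℕ} (u : L2Interval N) : SqSummable (extendZero N u) :=
  ⟨aestronglyMeasurable_count _, by rw [eLpNorm_extendZero]; exact enorm_lt_top⟩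

theorem l2norm_extendZero {N : ℕ} (u : L2Interval N) : l2norm (extendZero N u) = ‖u‖ := by
  rw [l2norm, eLpNorm_extendZero, toReal_enorm]

theorem extendZero_toeplitz_sub (a : ℤ → ℂ) (Nplus Nminus N : ℕ) (z : ℂ) (u : L2Interval N) :
    extendZero N ((toeplitz a Nplus Nminus N - z • ContinuousLinearMap.id ℂ (L2Interval N)) u) =
      (Set.Icc (1 : ℤ) N).indicator ((bandOp a Nplus Nminus - z • 1) (extendZero N u)) := by
  ext k
  by_cases hk : k ∈ Set.Icc (1 : ℤ) N
  · rw [extendZero_apply_of_mem _ (Finset.mem_Icc.2 hk), Set.indicator_of_mem hk]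
    simp only [LinearMap.sub_apply, LinearMap.smul_apply, Module.End.one_apply, Pi.sub_apply,
      Pi.smul_apply, smul_eq_mul, extendZero_apply_of_mem u (Finset.mem_Icc.2 hk)]
    rfl
  · rw [extendZero_apply_of_notMem _ hk, Set.indicator_of_notMem hk]

/-- At a fixed `z` of index zero, `P_N - z` is bounded below for large `N`. -/
theorem exists_toeplitz_bound (a : ℤ → ℂ) (Nplus Nminus : ℕ) {z : ℂ}
    (hz : z ∉ symbolCurve a Nplus Nminus) (hind : symbolIndex a Nplus Nminus z = 0) :
    ∃ m : ℝ, 0 < m ∧ ∃ N₀ : ℕ, ∀ N : ℕ, N₀ ≤ N → ∀ u : L2Interval N,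
      m * ‖u‖ ≤ ‖(toeplitz a Nplus Nminus N - z • ContinuousLinearMap.id ℂ (L2Interval N)) u‖ := by
  obtain ⟨c, hc, s, t, hs, ht, hB⟩ := exists_wienerHopf a Nplus Nminus hz hind
  have hc' := norm_pos_iff.2 hc
  set m := ‖c‖ * (revConst s * revConst t) with hm
  have hm0 : 0 < m := mul_pos hc' (mul_pos (revConst_pos hs) (revConst_pos ht))
  have hscale : ∀ (S : Set ℤ) (f : ℤ → ℂ),
      l2norm (S.indicator ((bandOp a Nplus Nminus - z • 1) f)) = ‖c‖ * l2norm (S.indicator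
        ((aeval shiftEnd (revProd s) * aeval shiftInv (revProd t)) f)) := fun S f => by
    rw [hB, LinearMap.smul_apply, ← l2norm_smul]
    congr 1
    ext k
    by_cases hk : k ∈ S <;> simp [hk]
  set K := ∑ j ∈ Finset.Icc (-(Nminus : ℤ)) (Nplus : ℤ), ‖a j‖ * |(j : ℝ)| with hK
  have hK0 : 0 ≤ K := Finset.sum_nonneg fun j _ => by positivity
  obtain ⟨N₁, hN₁⟩ := exists_nat_gt (4 * K / m)
  -- With K/N ≤ m/4 the commutator terms, doubled, absorb half of m; the factor 2 in
  -- `interval_bound` halves it again. The `+ 1` ensures N > 0.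
  refine ⟨m / 4, by positivity, N₁ + 1, fun N hN u => ?_⟩
  have hN0 : 0 < N := by omega
  have hN0' : (0 : ℝ) < N := by exact_mod_cast hN0
  have h1 := interval_bound a Nplus Nminus z (m := m)
    (fun f hf hfS => by
      rw [hscale, hm, mul_assoc]
      exact mul_le_mul_of_nonneg_left (half_line_bound_Ici hs ht 1 hf hfS) hc'.le)
    (fun n f hf hfS => by
      rw [hscale, hm, mul_assoc]
      exact mul_le_mul_of_nonneg_left (half_line_bound_Iic hs ht n hf hfS) hc'.le)
    hN0 hm0.le (sqSummable_extendZero u) (fun k hk => extendZero_apply_of_notMem u hk)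
  rw [← extendZero_toeplitz_sub, l2norm_extendZero, l2norm_extendZero, ← hK] at h1
  have h2 : (N : ℝ)⁻¹ * K ≤ m / 4 := by
    have h3 : (N₁ : ℝ) ≤ N := by exact_mod_cast (by omega : N₁ ≤ N)
    rw [div_lt_iff₀ hm0] at hN₁
    rw [inv_mul_le_iff₀ hN0']
    nlinarith
  have h4 := mul_le_mul_of_nonneg_right h2 (norm_nonneg u)
  linarith

/-! ### Invertibility and uniformity on Ω. -/

/-- A bound from below gives injectivity, hence bijectivity in finite dimension; applied to the
preimage of a vector, it bounds the inverse. -/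
theorem isUnit_and_norm_inverse_le {E : Type*} [NormedAddCommGroup E] [NormedSpace ℂ E]
    [FiniteDimensional ℂ E] (A : E →L[ℂ] E) {m : ℝ} (hm : 0 < m) (hA : ∀ u, m * ‖u‖ ≤ ‖A u‖) :
    IsUnit A ∧ ‖Ring.inverse A‖ ≤ m⁻¹ := by
  have hinj : Function.Injective A := (injective_iff_map_eq_zero A).2 fun u hu => by
    have := hA u
    rw [hu, norm_zero] at this
    exact norm_le_zero_iff.1 (nonpos_of_mul_nonpos_right this hm)
  let e : E ≃L[ℂ] E :=
    (LinearEquiv.ofInjectiveEndo (A : E →ₗ[ℂ] E) hinj).toContinuousLinearEquiv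
  have he : (e : E →L[ℂ] E) = A := by ext u; rfl
  have hunit : IsUnit A := ⟨ContinuousLinearEquiv.toUnit e, he⟩
  refine ⟨hunit, ContinuousLinearMap.opNorm_le_bound _ (inv_nonneg.2 hm.le) fun v => ?_⟩
  have h := hA (Ring.inverse A v)
  have h1 : A (Ring.inverse A v) = v := by
    rw [← mul_apply_eq_comp, Ring.mul_inverse_cancel A hunit]
    rfl
  rw [h1] at h
  rwa [inv_mul_eq_div, le_div_iff₀ hm, mul_comm]

end BandToeplitz

theorem proposition3p9 (Nplus Nminus : ℕ) (a : ℤ → ℂ)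
    (hN : Nplus ≠ 0 ∨ Nminus ≠ 0)
    (haplus : a (Nplus : ℤ) ≠ 0) (haminus : a (-(Nminus : ℤ)) ≠ 0)
    (Ω : Set ℂ) (hΩ : IsCompact Ω)
    (hΩsub : Ω ⊆ ({0} ∪ BandToeplitz.symbolCurve a Nplus Nminus)ᶜ)
    (ha₀ : ∀ z ∈ Ω, Nplus = 0 ∨ Nminus = 0 → a 0 ≠ z)
    (hind : ∀ z ∈ Ω, BandToeplitz.symbolIndex a Nplus Nminus z = 0) :
    ∃ C : ℝ, 0 < C ∧ ∃ N₀ : ℕ, ∀ N : ℕ, N₀ ≤ N → ∀ z ∈ Ω,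
      IsUnit (BandToeplitz.toeplitz a Nplus Nminus N -
          z • ContinuousLinearMap.id ℂ (BandToeplitz.L2Interval N)) ∧
        ‖Ring.inverse (BandToeplitz.toeplitz a Nplus Nminus N -
          z • ContinuousLinearMap.id ℂ (BandToeplitz.L2Interval N))‖ ≤ C := by
  suffices h : ∃ m : ℝ, 0 < m ∧ ∃ N₀ : ℕ, ∀ N : ℕ, N₀ ≤ N → ∀ z ∈ Ω,
      ∀ u : BandToeplitz.L2Interval N, m * ‖u‖ ≤ ‖(BandToeplitz.toeplitz a Nplus Nminus N -
          z • ContinuousLinearMap.id ℂ (BandToeplitz.L2Interval N)) u‖ by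
    obtain ⟨m, hm, N₀, h⟩ := h
    exact ⟨m⁻¹, inv_pos.2 hm, N₀, fun N hN z hz =>
      BandToeplitz.isUnit_and_norm_inverse_le _ hm (h N hN z hz)⟩
  -- Uniform lower bounds pass to subsets and finite unions, so by compactness they are only needed
  -- near each point.
  refine hΩ.induction_on (p := fun Ω => ∃ m : ℝ, 0 < m ∧ ∃ N₀ : ℕ, ∀ N : ℕ, N₀ ≤ N → ∀ z ∈ Ω,
      ∀ u : BandToeplitz.L2Interval N, m * ‖u‖ ≤ ‖(BandToeplitz.toeplitz a Nplus Nminus N -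
          z • ContinuousLinearMap.id ℂ (BandToeplitz.L2Interval N)) u‖) ?_ ?_ ?_ ?_
  · exact ⟨1, one_pos, 0, fun N _ z hz => hz.elim⟩
  · rintro s t hst ⟨m, hm, N₀, h⟩
    exact ⟨m, hm, N₀, fun N hN z hz => h N hN z (hst hz)⟩
  · rintro s t ⟨m, hm, N₀, h⟩ ⟨m', hm', N₀', h'⟩
    refine ⟨min m m', lt_min hm hm', max N₀ N₀', fun N hN z hz u => ?_⟩
    rcases hz with hz | hz
    · exact (mul_le_mul_of_nonneg_right (min_le_left _ _) (norm_nonneg u)).trans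
        (h N ((le_max_left _ _).trans hN) z hz u)
    · exact (mul_le_mul_of_nonneg_right (min_le_right _ _) (norm_nonneg u)).trans
        (h' N ((le_max_right _ _).trans hN) z hz u)
  · intro z hz
    obtain ⟨m, hm, N₀, h⟩ := BandToeplitz.exists_toeplitz_bound a Nplus Nminus
      (fun hc => hΩsub hz (Or.inr hc)) (hind z hz)
    -- Moving `z` by less than m/2 costs at most half of the lower bound, with the same N₀.
    refine ⟨Metric.ball z (m / 2), mem_nhdsWithin_of_mem_nhds (Metric.ball_mem_nhds z (by positivity)),
      m / 2, by positivity, N₀, fun N hN w hw u => ?_⟩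
    have h1 := h N hN u
    have h2 : (BandToeplitz.toeplitz a Nplus Nminus N -
        z • ContinuousLinearMap.id ℂ (BandToeplitz.L2Interval N)) u =
        (BandToeplitz.toeplitz a Nplus Nminus N -
          w • ContinuousLinearMap.id ℂ (BandToeplitz.L2Interval N)) u + (w - z) • u := by
      simp [sub_smul]
    have h3 : ‖(w - z) • u‖ ≤ m / 2 * ‖u‖ := by
      rw [norm_smul]
      gcongr
      exact (mem_ball_iff_norm.1 hw).le
    rw [h2] at h1
    have h4 := norm_add_le ((BandToeplitz.toeplitz a Nplus Nminus N -
          w • ContinuousLinearMap.id ℂ (BandToeplitz.L2Interval N)) u) ((w - z) • u)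
    linarith
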